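/- (Separation and the forward difference) Let $X=(X_i)_{i\in V}$, $V$ finite, be random variables on a probability space, with values in arbitrary measurable spaces, whose joint law has a density with respect to a product $\bigotimes_{i\in V}\mu_i$ of $\sigma$-finite measures (for instance Lebesgue or counting measures). For $S\subseteq V$ let $X_S=(X_i)_{i\in S}$, let $f_S$ be the density of $X_S$ with respect to $\bigotimes_{i\in S}\mu_i$, and assume that $\log f_S(X_S)$ is integrable for every $S\subseteq V$, so that all entropies are well defined and finite. For disjoint $S,C\subseteq V$ define the conditional entropy $$h_{S|C}=-\mathbb E\log f_{S|C}(X_S|X_C),\qquad f_{S|C}=f_{S\cup C}/f_C ,$$ and the conditional forward difference $$\delta_{S|C}=\sum_{D\subseteq S}(-1)^{|S|-|D|}\,h_{D|C}.$$ Let $A,B,C\subseteq V$ be pairwise disjoint with $A$ and $B$ non-empty. A set $C$ separates $A$ and $B$ in an undirected graph on $V$ if every path from a node of $A$ to a node of $B$ contains a node of $C$. (i) Let $G$ be the conditional independence graph of $X$, in which distinct nodes $i,j$ are non-adjacent exactly when $X_i\perp X_j\mid X_{V\setminus\{i,j\}}$, and suppose that the joint density is positive, in the sense that the product of the marginal laws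 of the $X_i$ is absolutely continuous with respect to the joint law of $X$. If $C$ separates $A$ and $B$ in $G$, then $X_A\perp X_B\mid X_C$, the conditional entropy is additive, $h_{A\cup B|C}=h_{A|C}+h_{B|C}$, and $$\delta_{A\cup B|C}=0 .$$ (ii) The same conclusions hold, without the positivity assumption, whenever $C$ separates $A$ and $B$ in an undirected graph $G$ on $V$ for which $X$ has the global Markov property, that is, $X_{A'}\perp X_{B'}\mid X_{C'}$ for all pairwise disjoint $A',B',C'\subseteq V$ such that $C'$ separates $A'$ and $B'$ in $G$. -/

import Mathlib

open MeasureTheory ProbabilityTheory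
open scoped ENNReal

namespace ForwardDifference

section Probability

variable {ι Ω : Type*} {E : ι → Type*} [∀ i, MeasurableSpace (E i)] [MeasurableSpace Ω]

/-- The subvector `X_A = (X_i ; i ∈ A)`. -/
def subvector (X : ∀ i, Ω → E i) (A : Finset ι) (ω : Ω) : ∀ i : A, E i :=
  fun i => X i ω

/-- The marginal density `f_A`: the derivative of the law of `X_A` with respect to the product
of the reference measures `μ i`, `i ∈ A` (Lebesgue measure for continuous variables, counting
measure for discrete ones). -/
noncomputable def density (μ : ∀ i, Measure (E i)) (P : Measure Ω) (X : ∀ i, Ω → E i)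
    (A : Finset ι) : (∀ i : A, E i) → ℝ≥0∞ :=
  (P.map (subvector X A)).rnDeriv (Measure.pi fun i : A => μ i)

/-- The random variable `log f_A(X_A)`, whose negative expectation is the entropy of `X_A`. -/
noncomputable def logDensity (μ : ∀ i, Measure (E i)) (P : Measure Ω) (X : ∀ i, Ω → E i)
    (A : Finset ι) (ω : Ω) : ℝ :=
  Real.log (density μ P X A (subvector X A ω)).toReal

/-- The conditional density `f_{A|C}(X_A | X_C) = f_{A ∪ C}(X_{A ∪ C}) / f_C(X_C)`,
as a random variable. -/
noncomputable def condDensity [DecidableEq ι] (μ : ∀ i, Measure (E i)) (P : Measure Ω)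
    (X : ∀ i, Ω → E i) (A C : Finset ι) (ω : Ω) : ℝ :=
  (density μ P X (A ∪ C) (subvector X (A ∪ C) ω)).toReal /
    (density μ P X C (subvector X C ω)).toReal

/-- The conditional entropy `h_{A|C} = -E log f_{A|C}(X_A | X_C)`. -/
noncomputable def condEntropy [DecidableEq ι] (μ : ∀ i, Measure (E i)) (P : Measure Ω)
    (X : ∀ i, Ω → E i) (A C : Finset ι) : ℝ :=
  -∫ ω, Real.log (condDensity μ P X A C ω) ∂P

/-- The forward difference of a set function `h`, by Möbius inversion of
`h A = ∑ B ⊆ A, δ B`. -/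
def forwardDiff (h : Finset ι → ℝ) (A : Finset ι) : ℝ :=
  ∑ B ∈ A.powerset, (-1) ^ (A.card - B.card) * h B

/-- The conditional forward difference `δ_{A|C}`: the forward difference at `A` of the
conditional entropy function `S ↦ h_{S|C}`. -/
noncomputable def condForwardDiff [DecidableEq ι] (μ : ∀ i, Measure (E i)) (P : Measure Ω)
    (X : ∀ i, Ω → E i) (A C : Finset ι) : ℝ :=
  forwardDiff (fun S => condEntropy μ P X S C) A

/-- Conditional independence `X_A ⊥ X_B | X_C`: conditionally on the σ-algebra generated by
`X_C`, the events `X_A ∈ s` and `X_B ∈ t` are independent. On a standard Borel sample space this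
is Mathlib's `CondIndepFun`, see `condIndep_iff_condIndepFun`. -/
def CondIndep (P : Measure Ω) (X : ∀ i, Ω → E i) (A B C : Finset ι) : Prop :=
  ∀ (s : Set (∀ i : A, E i)) (t : Set (∀ i : B, E i)), MeasurableSet s → MeasurableSet t →
    P⟦subvector X A ⁻¹' s ∩ subvector X B ⁻¹' t |
        MeasurableSpace.comap (subvector X C) inferInstance⟧
      =ᵐ[P] fun ω =>
        (P⟦subvector X A ⁻¹' s | MeasurableSpace.comap (subvector X C) inferInstance⟧) ω *
          (P⟦subvector X B ⁻¹' t | MeasurableSpace.comap (subvector X C) inferInstance⟧) ω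

theorem measurable_subvector {X : ∀ i, Ω → E i} (hX : ∀ i, Measurable (X i)) (A : Finset ι) :
    Measurable (subvector X A) :=
  measurable_pi_lambda _ fun i => hX i

theorem condIndep_iff_condIndepFun [StandardBorelSpace Ω] (P : Measure Ω) [IsFiniteMeasure P]
    {X : ∀ i, Ω → E i} (hX : ∀ i, Measurable (X i)) (A B C : Finset ι) :
    CondIndep P X A B C ↔
      CondIndepFun (MeasurableSpace.comap (subvector X C) inferInstance)
        (measurable_subvector hX C).comap_le (subvector X A) (subvector X B) P := by
  rw [condIndepFun_iff_condExp_inter_preimage_eq_mul (measurable_subvector hX A)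
    (measurable_subvector hX B)]
  rfl

theorem CondIndep.symm {P : Measure Ω} {X : ∀ i, Ω → E i} {A B C : Finset ι}
    (h : CondIndep P X A B C) : CondIndep P X B A C := by
  intro s t hs ht
  have := h t s ht hs
  rw [Set.inter_comm]
  filter_upwards [this] with ω hω
  rw [hω, mul_comm]

end Probability

section Graph

variable {ι Ω : Type*} {E : ι → Type*} [∀ i, MeasurableSpace (E i)] [MeasurableSpace Ω]

/-- `C` separates `A` and `B` in `G`: every walk from a node of `A` to a node of `B` meets `C`. -/
def Separates (G : SimpleGraph ι) (C A B : Finset ι) : Prop :=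
  ∀ a ∈ A, ∀ b ∈ B, ∀ w : G.Walk a b, ∃ v ∈ w.support, v ∈ C

/-- The conditional independence graph of `X`: distinct nodes `i`, `j` are not joined by an edge
exactly when `X_i ⊥ X_j` given all the remaining variables. -/
def condIndepGraph [Fintype ι] [DecidableEq ι] (P : Measure Ω) (X : ∀ i, Ω → E i) :
    SimpleGraph ι where
  Adj i j := i ≠ j ∧ ¬ CondIndep P X {i} {j} (Finset.univ \ {i, j})
  symm := ⟨fun i j h => ⟨h.1.symm, fun hc => h.2 (by
    have := hc.symm
    rwa [Finset.pair_comm] at this)⟩⟩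
  loopless := ⟨fun _ h => h.1 rfl⟩

/-- The global Markov property: separation in `G` implies conditional independence. -/
def IsGlobalMarkov (G : SimpleGraph ι) (P : Measure Ω) (X : ∀ i, Ω → E i) : Prop :=
  ∀ A B C : Finset ι, Disjoint A B → Disjoint A C → Disjoint B C →
    Separates G C A B → CondIndep P X A B C

end Graph

end ForwardDifference

/-!
Separation in a graph with the global Markov property gives `X_A ⊥ X_B | X_C` directly. For the
conditional independence graph of a law with positive density, the global Markov property has to be
derived from the pairwise one. The key is the intersection property of conditional independence.
By positivity, and because a law dominated by a product measure is dominated by the product of its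
own marginals (`absolutelyContinuous_pi_map_eval`), the joint law has the same null sets as a product
of probability measures. A conditional probability of an `X_A`-event that is both a function of
`X_S` and a function of `X_T` is then a function of `X_{S ∩ T}`, by freezing the coordinates outside
`S` at a generic value (`exists_ae_eq_comp_restrict_inter`). Hence sets of nodes with no edge between
them are conditionally independent given all the other nodes, by induction from pairs of nodes
(`condIndep_compl_of_forall_not_adj`). If `C` separates `A` from `B`, enlarge `A` to everything
reachable from it off `C` and `B` to the rest of the complement of `C`; no edge joins the enlarged
sets, and passing back to `A` and `B` is harmless.

Conditional independence makes the joint density factorize, `f_{A ∪ B ∪ C} f_C = f_{A ∪ C} f_{B ∪ C}`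
almost surely: the measure with density `f_{B ∪ C} f_{A ∪ C} / f_C` agrees with the joint law on
rectangles, because `∫_s f_{A ∪ C}(a, c) da / f_C(c)` is the conditional probability of `X_A ∈ s`
given `X_C`, and also given `X_{B ∪ C}` (`rnDeriv_prod_ae_eq_of_condExp_eq`). Taking logarithms and
expectations gives the additivity of the conditional entropy. This applies to all subsets of `A` and
`B`, so on subsets of `A ∪ B` the conditional entropy is a function of the part in `A` plus a
function of the part in `B`, and its alternating sum vanishes as both sets are non-empty
(`forwardDiff_union_eq_zero`).
-/

namespace ForwardDifference

/-! ### Conditional independence and conditional probabilities -/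

section SigmaAlgebras

variable {Ω : Type*} {mB mC m₀ : MeasurableSpace Ω} {P : Measure Ω} [IsProbabilityMeasure P]

theorem sup_eq_generateFrom_inter (m₁ m₂ : MeasurableSpace Ω) :
    m₁ ⊔ m₂ = MeasurableSpace.generateFrom
      {s | ∃ F G, MeasurableSet[m₁] F ∧ MeasurableSet[m₂] G ∧ F ∩ G = s} := by
  refine le_antisymm (sup_le (fun s hs => ?_) fun s hs => ?_)
    (MeasurableSpace.generateFrom_le ?_)
  · exact MeasurableSpace.measurableSet_generateFrom
      ⟨s, Set.univ, hs, @MeasurableSet.univ _ m₂, Set.inter_univ s⟩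
  · exact MeasurableSpace.measurableSet_generateFrom
      ⟨Set.univ, s, @MeasurableSet.univ _ m₁, hs, Set.univ_inter s⟩
  · rintro s ⟨F, G, hF, hG, rfl⟩
    exact @MeasurableSet.inter _ (m₁ ⊔ m₂) _ _ (le_sup_left (a := m₁) F hF)
      (le_sup_right (b := m₂) G hG)

theorem isPiSystem_inter (m₁ m₂ : MeasurableSpace Ω) :
    IsPiSystem {s | ∃ F G, MeasurableSet[m₁] F ∧ MeasurableSet[m₂] G ∧ F ∩ G = s} := by
  rintro _ ⟨F, G, hF, hG, rfl⟩ _ ⟨F', G', hF', hG', rfl⟩ -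
  exact ⟨F ∩ F', G ∩ G', @MeasurableSet.inter _ m₁ _ _ hF hF',
    @MeasurableSet.inter _ m₂ _ _ hG hG', Set.inter_inter_inter_comm _ _ _ _⟩

theorem integrable_indicator_one {F : Set Ω} (hF : MeasurableSet F) :
    Integrable (F.indicator fun _ => (1 : ℝ)) P :=
  (integrable_const 1).indicator hF

theorem indicator_one_mul {Ω : Type*} (F : Set Ω) (g : Ω → ℝ) :
    (F.indicator (fun _ => (1 : ℝ))) * g = F.indicator g := by
  ext ω
  by_cases h : ω ∈ F <;> simp [h]

/-- If every event of `mB` is conditionally independent of `F` given `mC`, then `mB` carries no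
information on `F` beyond that of `mC`. The two sides have the same integrals over the π-system of
the sets `G ∩ H` with `G ∈ mB`, `H ∈ mC`. -/
theorem condExp_sup_eq_of_forall_inter (hB : mB ≤ m₀) (hC : mC ≤ m₀) {F : Set Ω}
    (hF : MeasurableSet F)
    (h : ∀ G, MeasurableSet[mB] G → P⟦F ∩ G | mC⟧ =ᵐ[P] P⟦F | mC⟧ * P⟦G | mC⟧) :
    P⟦F | mB ⊔ mC⟧ =ᵐ[P] P⟦F | mC⟧ := by
  have hBC : mB ⊔ mC ≤ m₀ := sup_le hB hC
  have hi : Integrable (P⟦F | mC⟧) P := integrable_condExp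
  have hFi : Integrable (F.indicator fun _ => (1 : ℝ)) P := integrable_indicator_one hF
  have hm : StronglyMeasurable[mB ⊔ mC] (P⟦F | mC⟧) :=
    stronglyMeasurable_condExp.mono le_sup_right
  symm
  refine ae_eq_condExp_of_forall_setIntegral_eq hBC hFi (fun _ _ _ => hi.integrableOn) ?_
    hm.aestronglyMeasurable
  intro s hs _
  refine MeasurableSpace.induction_on_inter
    (C := fun s _ => ∫ ω in s, (P⟦F | mC⟧) ω ∂P = ∫ ω in s, F.indicator (fun _ => (1 : ℝ)) ω ∂P)
    (sup_eq_generateFrom_inter mB mC) (isPiSystem_inter mB mC) (by simp) ?_ ?_ ?_ s hs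
  · rintro _ ⟨G, H, hG, hH, rfl⟩
    have hG' := hB G hG
    have hH' := hC H hH
    have hGi : Integrable (G.indicator fun _ => (1 : ℝ)) P := integrable_indicator_one hG'
    have hprod : Integrable (P⟦F | mC⟧ * G.indicator fun _ => (1 : ℝ)) P := by
      rw [mul_comm, indicator_one_mul]
      exact hi.indicator hG'
    have key : P[P⟦F | mC⟧ * G.indicator (fun _ => (1 : ℝ)) | mC] =ᵐ[P] P⟦F ∩ G | mC⟧ :=
      (condExp_mul_of_stronglyMeasurable_left stronglyMeasurable_condExp hprod hGi).trans
        (h G hG).symm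
    calc ∫ ω in G ∩ H, (P⟦F | mC⟧) ω ∂P
        = ∫ ω in H, (P⟦F | mC⟧ * G.indicator fun _ => (1 : ℝ)) ω ∂P := by
          rw [mul_comm, indicator_one_mul, setIntegral_indicator hG', Set.inter_comm]
      _ = ∫ ω in H, (P[P⟦F | mC⟧ * G.indicator (fun _ => (1 : ℝ)) | mC]) ω ∂P :=
          (setIntegral_condExp hC hprod hH).symm
      _ = ∫ ω in H, (P⟦F ∩ G | mC⟧) ω ∂P :=
          integral_congr_ae (ae_restrict_of_ae key)
      _ = ∫ ω in H, (F ∩ G).indicator (fun _ => (1 : ℝ)) ω ∂P :=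
          setIntegral_condExp hC (integrable_indicator_one (hF.inter hG')) hH
      _ = ∫ ω in G ∩ H, F.indicator (fun _ => (1 : ℝ)) ω ∂P := by
          rw [setIntegral_indicator (hF.inter hG'), setIntegral_indicator hF]
          congr 2
          ext ω
          simp only [Set.mem_inter_iff]
          tauto
  · intro t ht ht'
    have h1 := integral_add_compl (hBC t ht) hi
    have h2 := integral_add_compl (hBC t ht) hFi
    rw [integral_condExp hC] at h1
    linarith
  · intro f hd hf hfe
    rw [integral_iUnion (fun i => hBC _ (hf i)) hd hi.integrableOn,
      integral_iUnion (fun i => hBC _ (hf i)) hd hFi.integrableOn]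
    exact tsum_congr hfe

/-- If `mB` carries no information on `F` beyond that of `mC`, then `F` is conditionally
independent of `mB` given `mC`. -/
theorem condExp_inter_eq_of_condExp_sup_eq (hB : mB ≤ m₀) (hC : mC ≤ m₀) {F G : Set Ω}
    (hF : MeasurableSet F) (hG : MeasurableSet[mB] G)
    (h : P⟦F | mB ⊔ mC⟧ =ᵐ[P] P⟦F | mC⟧) :
    P⟦F ∩ G | mC⟧ =ᵐ[P] P⟦F | mC⟧ * P⟦G | mC⟧ := by
  have hBC : mB ⊔ mC ≤ m₀ := sup_le hB hC
  have hG' := hB G hG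
  have hFi : Integrable (F.indicator fun _ => (1 : ℝ)) P := integrable_indicator_one hF
  have hGi : Integrable (G.indicator fun _ => (1 : ℝ)) P := integrable_indicator_one hG'
  have hmul : (F ∩ G).indicator (fun _ => (1 : ℝ))
      = G.indicator (fun _ => (1 : ℝ)) * F.indicator fun _ => (1 : ℝ) := by
    rw [indicator_one_mul, Set.indicator_indicator, Set.inter_comm]
  have hint : Integrable (G.indicator (fun _ => (1 : ℝ)) * F.indicator fun _ => (1 : ℝ)) P := by
    rw [← hmul]; exact integrable_indicator_one (hF.inter hG')
  have hint' : Integrable (P⟦F | mC⟧ * G.indicator fun _ => (1 : ℝ)) P := by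
    rw [mul_comm, indicator_one_mul]
    exact integrable_condExp.indicator hG'
  have hGm : StronglyMeasurable[mB ⊔ mC] (G.indicator fun _ => (1 : ℝ)) :=
    (@stronglyMeasurable_const _ _ (mB ⊔ mC) _ 1).indicator (le_sup_left (a := mB) G hG)
  -- condition on `mB ⊔ mC` first, where the indicator of `G` can be pulled out
  have h1 : P⟦F ∩ G | mB ⊔ mC⟧ =ᵐ[P] P⟦F | mC⟧ * G.indicator fun _ => (1 : ℝ) := by
    rw [hmul]
    filter_upwards [condExp_mul_of_stronglyMeasurable_left hGm hint hFi, h] with ω h2 h3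
    rw [h2, Pi.mul_apply, Pi.mul_apply, h3, mul_comm]
  exact (condExp_condExp_of_le le_sup_right hBC).symm.trans <|
    (condExp_congr_ae h1).trans <|
      condExp_mul_of_stronglyMeasurable_left stronglyMeasurable_condExp hint' hGi

end SigmaAlgebras

section Subvectors

variable {ι Ω : Type*} {E : ι → Type*} [∀ i, MeasurableSpace (E i)]

/-- The σ-algebra generated by the subvector `X_S`. -/
abbrev sigmaAlg (X : ∀ i, Ω → E i) (S : Finset ι) : MeasurableSpace Ω :=
  MeasurableSpace.comap (subvector X S) inferInstance

theorem sigmaAlg_le [MeasurableSpace Ω] {X : ∀ i, Ω → E i} (hX : ∀ i, Measurable (X i))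
    (S : Finset ι) : sigmaAlg X S ≤ ‹MeasurableSpace Ω› :=
  (measurable_subvector hX S).comap_le

theorem sigmaAlg_eq_iSup (X : ∀ i, Ω → E i) (S : Finset ι) :
    sigmaAlg X S = ⨆ i ∈ S, MeasurableSpace.comap (X i) inferInstance := by
  simp only [sigmaAlg, MeasurableSpace.pi, MeasurableSpace.comap_iSup,
    MeasurableSpace.comap_comp, iSup_subtype]
  rfl

theorem sigmaAlg_mono (X : ∀ i, Ω → E i) {S T : Finset ι} (h : S ⊆ T) :
    sigmaAlg X S ≤ sigmaAlg X T := by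
  simp only [sigmaAlg_eq_iSup]
  exact biSup_mono fun i hi => h hi

theorem sigmaAlg_union [DecidableEq ι] (X : ∀ i, Ω → E i) (S T : Finset ι) :
    sigmaAlg X (S ∪ T) = sigmaAlg X S ⊔ sigmaAlg X T := by
  simp only [sigmaAlg_eq_iSup, Finset.mem_union, iSup_or, iSup_sup_eq]

variable [MeasurableSpace Ω]

theorem condIndep_iff_forall_measurableSet {P : Measure Ω} {X : ∀ i, Ω → E i} {A B C : Finset ι} :
    CondIndep P X A B C ↔ ∀ F G, MeasurableSet[sigmaAlg X A] F → MeasurableSet[sigmaAlg X B] G →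
      P⟦F ∩ G | sigmaAlg X C⟧ =ᵐ[P] P⟦F | sigmaAlg X C⟧ * P⟦G | sigmaAlg X C⟧ := by
  constructor
  · rintro h _ _ ⟨s, hs, rfl⟩ ⟨t, ht, rfl⟩
    exact h s t hs ht
  · intro h s t hs ht
    exact h _ _ ⟨s, hs, rfl⟩ ⟨t, ht, rfl⟩

theorem CondIndep.mono {P : Measure Ω} {X : ∀ i, Ω → E i} {A A' B B' C : Finset ι}
    (h : CondIndep P X A B C) (hA : A' ⊆ A) (hB : B' ⊆ B) : CondIndep P X A' B' C := by
  rw [condIndep_iff_forall_measurableSet] at h ⊢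
  exact fun F G hF hG => h F G (sigmaAlg_mono X hA F hF) (sigmaAlg_mono X hB G hG)

/-- Conditional independence as a Markov property: given `X_C`, the vector `X_B` does not change
the conditional probabilities of the events determined by `X_A`. -/
theorem condIndep_iff_condExp_eq [DecidableEq ι] {P : Measure Ω} [IsProbabilityMeasure P]
    {X : ∀ i, Ω → E i} (hX : ∀ i, Measurable (X i)) {A B C : Finset ι} :
    CondIndep P X A B C ↔ ∀ F, MeasurableSet[sigmaAlg X A] F →
      P⟦F | sigmaAlg X (B ∪ C)⟧ =ᵐ[P] P⟦F | sigmaAlg X C⟧ := by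
  rw [condIndep_iff_forall_measurableSet, sigmaAlg_union]
  constructor
  · intro h F hF
    exact condExp_sup_eq_of_forall_inter (sigmaAlg_le hX B) (sigmaAlg_le hX C)
      (sigmaAlg_le hX A F hF) fun G hG => h F G hF hG
  · intro h F G hF hG
    exact condExp_inter_eq_of_condExp_sup_eq (sigmaAlg_le hX B) (sigmaAlg_le hX C)
      (sigmaAlg_le hX A F hF) hG (h F hF)

end Subvectors

/-! ### Absolute continuity of product measures -/

section ProductMeasures

variable {ι : Type*} {E : ι → Type*} [∀ i, MeasurableSpace (E i)]

theorem pi_finset_absolutelyContinuous [DecidableEq ι] {α β : ∀ i, Measure (E i)}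
    [∀ i, SigmaFinite (α i)] [∀ i, SigmaFinite (β i)] (h : ∀ i, α i ≪ β i) (S : Finset ι) :
    Measure.pi (fun i : S => α i) ≪ Measure.pi fun i : S => β i := by
  induction S using Finset.induction_on with
  | empty => rw [Measure.pi_of_empty, Measure.pi_of_empty]
  | insert a S ha ih =>
    have hd : Disjoint {a} S := by simpa using ha
    have hsing : Measure.pi (fun i : ({a} : Finset ι) => α i)
        ≪ Measure.pi fun i : ({a} : Finset ι) => β i := by
      rw [← (measurePreserving_piUnique fun i : ({a} : Finset ι) => α i).symm.map_eq,
        ← (measurePreserving_piUnique fun i : ({a} : Finset ι) => β i).symm.map_eq]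
      exact (h _).map (MeasurableEquiv.measurable _)
    rw [Finset.insert_eq, ← (measurePreserving_piFinsetUnion hd α).map_eq,
      ← (measurePreserving_piFinsetUnion hd β).map_eq]
    exact (hsing.prod ih).map (MeasurableEquiv.measurable _)

variable [Fintype ι]

theorem pi_absolutelyContinuous {α β : ∀ i, Measure (E i)}
    [∀ i, SigmaFinite (α i)] [∀ i, SigmaFinite (β i)] (h : ∀ i, α i ≪ β i) :
    Measure.pi α ≪ Measure.pi β := by
  classical
  let e : (Finset.univ : Finset ι) ≃ ι := Equiv.subtypeUnivEquiv Finset.mem_univ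
  rw [← (measurePreserving_piCongrLeft α e).map_eq, ← (measurePreserving_piCongrLeft β e).map_eq]
  exact (pi_finset_absolutelyContinuous h Finset.univ).map (MeasurableEquiv.measurable _)

/-- Restriction to a set of coordinates maps null sets back to null sets. The total mass of the
remaining coordinates may be infinite, so that no marginalization formula is available. -/
theorem quasiMeasurePreserving_finset_restrict (μ : ∀ i, Measure (E i)) [∀ i, SigmaFinite (μ i)]
    (S : Finset ι) :
    Measure.QuasiMeasurePreserving (fun (x : ∀ i, E i) (i : S) => x i) (Measure.pi μ)
      (Measure.pi fun i : S => μ i) := by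
  classical
  have h := (Measure.quasiMeasurePreserving_fst).comp
    (measurePreserving_piEquivPiSubtypeProd μ (· ∈ S)).quasiMeasurePreserving
  convert! h

/-- A measure on a product that is dominated by some product measure is dominated by the product
of its marginals: it is carried by the box on which all the marginal densities are positive, and
there the marginals dominate the reference measures. -/
theorem absolutelyContinuous_pi_map_eval {μ : ∀ i, Measure (E i)} [∀ i, SigmaFinite (μ i)]
    {Q : Measure (∀ i, E i)} [IsProbabilityMeasure Q] (hQ : Q ≪ Measure.pi μ) :
    Q ≪ Measure.pi fun i => Q.map fun x => x i := by
  have hprob (i : ι) : IsProbabilityMeasure (Q.map fun x => x i) :=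
    Measure.isProbabilityMeasure_map (measurable_pi_apply i).aemeasurable
  have hac (i : ι) : Q.map (fun x => x i) ≪ μ i :=
    (hQ.map (measurable_pi_apply i)).trans
      (Measure.quasiMeasurePreserving_eval μ i).absolutelyContinuous
  let f (i : ι) : E i → ℝ≥0∞ := (Q.map fun x => x i).rnDeriv (μ i)
  let T (i : ι) : Set (E i) := {x | f i x ≠ 0}
  have hT (i : ι) : MeasurableSet (T i) :=
    (Measure.measurable_rnDeriv _ _) (measurableSet_singleton 0).compl
  have hcarrier : ∀ᵐ x ∂Q, x ∈ Set.univ.pi T := by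
    have (i : ι) : ∀ᵐ x ∂Q, x i ∈ T i :=
      ae_of_ae_map (measurable_pi_apply i).aemeasurable
        ((Measure.rnDeriv_pos (hac i)).mono fun _ h => h.ne')
    filter_upwards [ae_all_iff.2 this] with x hx i _ using hx i
  have hdom (i : ι) : (μ i).restrict (T i) ≪ Q.map fun x => x i := by
    conv_rhs => rw [← Measure.withDensity_rnDeriv_eq _ _ (hac i)]
    have h : (μ i).restrict (T i) ≪ ((μ i).restrict (T i)).withDensity (f i) :=
      withDensity_absolutelyContinuous' (Measure.measurable_rnDeriv _ _).aemeasurable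
        (ae_restrict_mem (hT i))
    refine h.trans ?_
    rw [← restrict_withDensity (hT i)]
    exact Measure.restrict_le_self.absolutelyContinuous
  have hbox : (Measure.pi μ).restrict (Set.univ.pi T) ≪ Measure.pi fun i => Q.map fun x => x i := by
    rw [Measure.restrict_pi_pi]
    exact pi_absolutelyContinuous hdom
  refine Measure.AbsolutelyContinuous.trans ?_ hbox
  rw [← Measure.restrict_eq_self_of_ae_mem hcarrier]
  exact hQ.restrict _

/-- If a function of the coordinates in `S` agrees almost everywhere, under a product of probability
measures, with a function of the coordinates in `T`, then it agrees almost everywhere with a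
function of the coordinates in `S ∩ T`: freeze the coordinates outside `S` at a generic value. -/
theorem exists_ae_eq_comp_restrict_inter [DecidableEq ι] (ν : ∀ i, Measure (E i))
    [∀ i, IsProbabilityMeasure (ν i)] {S T : Finset ι} {u : (∀ i : S, E i) → ℝ}
    {v : (∀ i : T, E i) → ℝ} (hu : Measurable u) (hv : Measurable v)
    (huv : ∀ᵐ x ∂Measure.pi ν, u (fun i => x i) = v fun i => x i) :
    ∃ w : (∀ i : (S ∩ T : Finset ι), E i) → ℝ, Measurable w ∧
      ∀ᵐ x ∂Measure.pi ν, u (fun i => x i) = w fun i => x i := by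
  let e := MeasurableEquiv.piEquivPiSubtypeProd E (· ∈ S)
  have he : MeasurePreserving e (Measure.pi ν) ((Measure.pi fun i : S => ν i).prod
      (Measure.pi fun i : {i // i ∉ S} => ν i)) := by
    convert! measurePreserving_piEquivPiSubtypeProd ν (· ∈ S)
  have hset : MeasurableSet {x : ∀ i, E i | u (fun i => x i) = v fun i => x i} :=
    measurableSet_eq_fun (by fun_prop) (by fun_prop)
  have h1 : ∀ᵐ z ∂(Measure.pi fun i : S => ν i).prod
      (Measure.pi fun i : {i // i ∉ S} => ν i),
      u (fun i => e.symm z i) = v fun i => e.symm z i :=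
    (he.symm e).quasiMeasurePreserving.ae huv
  have h2 := (Measure.ae_ae_comm (p := fun x y => u (fun i => e.symm (x, y) i)
    = v fun i => e.symm (x, y) i) (e.symm.measurable hset)).1 (Measure.ae_ae_of_ae_prod h1)
  obtain ⟨y, hy⟩ := h2.exists
  refine ⟨fun z => v fun i => if h : (i : ι) ∈ S then z ⟨i, Finset.mem_inter.2 ⟨h, i.2⟩⟩
    else y ⟨i, h⟩, ?_, ?_⟩
  · refine hv.comp (measurable_pi_lambda _ fun i => ?_)
    by_cases h : (i : ι) ∈ S
    · simpa only [h, dif_pos] using measurable_pi_apply _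
    · simp only [h, dif_neg, not_false_eq_true, measurable_const]
  · have h3 := (Measure.quasiMeasurePreserving_fst.comp he.quasiMeasurePreserving).ae hy
    filter_upwards [h3] with x hx
    have hl : (fun i : S => e.symm ((e x).1, y) i) = fun i : S => x i := by
      ext i
      simp [e, MeasurableEquiv.piEquivPiSubtypeProd, Equiv.piEquivPiSubtypeProd]
    have hr : (fun i : T => e.symm ((e x).1, y) i)
        = fun i : T => if h : (i : ι) ∈ S then x i else y ⟨i, h⟩ := by
      ext i
      simp [e, MeasurableEquiv.piEquivPiSubtypeProd, Equiv.piEquivPiSubtypeProd]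
    rw [← hl, ← hr]
    exact hx

end ProductMeasures

/-! ### From the pairwise to the global Markov property -/

section Markov

variable {ι Ω : Type*} [Fintype ι] [DecidableEq ι] {E : ι → Type*} [∀ i, MeasurableSpace (E i)]
  [MeasurableSpace Ω] {P : Measure Ω} [IsProbabilityMeasure P] {X : ∀ i, Ω → E i}

/-- If the joint law is equivalent to a product measure, a random variable that is, up to null
sets, both a function of `X_S` and a function of `X_T` is a function of `X_{S ∩ T}`. -/
theorem exists_ae_eq_sigmaAlg_inter (hX : ∀ i, Measurable (X i))
    (hpos : Measure.pi (fun i => P.map (X i)) ≪ P.map fun ω i => X i ω)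
    (hdom : P.map (fun ω i => X i ω) ≪ Measure.pi fun i => P.map (X i))
    {S T : Finset ι} {f g : Ω → ℝ} (hf : StronglyMeasurable[sigmaAlg X S] f)
    (hg : StronglyMeasurable[sigmaAlg X T] g) (hfg : f =ᵐ[P] g) :
    ∃ w : Ω → ℝ, StronglyMeasurable[sigmaAlg X (S ∩ T)] w ∧ f =ᵐ[P] w := by
  have hprob (i : ι) : IsProbabilityMeasure (P.map (X i)) :=
    Measure.isProbabilityMeasure_map (hX i).aemeasurable
  have hXm : Measurable fun ω i => X i ω := measurable_pi_lambda _ hX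
  obtain ⟨u, hu, rfl⟩ := hf.measurable.exists_eq_measurable_comp
  obtain ⟨v, hv, rfl⟩ := hg.measurable.exists_eq_measurable_comp
  have huv : ∀ᵐ x ∂Measure.pi fun i => P.map (X i), u (fun i => x i) = v fun i => x i := by
    refine hpos.ae_le ((ae_map_iff hXm.aemeasurable ?_).2 hfg)
    exact measurableSet_eq_fun (by fun_prop) (by fun_prop)
  obtain ⟨w, hw, huw⟩ := exists_ae_eq_comp_restrict_inter _ hu hv huv
  exact ⟨w ∘ subvector X (S ∩ T), (hw.comp (comap_measurable _)).stronglyMeasurable,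
    ae_of_ae_map hXm.aemeasurable (hdom.ae_le huw)⟩

/-- The intersection property of conditional independence, for conditioning on all the remaining
variables. -/
theorem CondIndep.union_right_compl (hX : ∀ i, Measurable (X i))
    (hpos : Measure.pi (fun i => P.map (X i)) ≪ P.map fun ω i => X i ω)
    (hdom : P.map (fun ω i => X i ω) ≪ Measure.pi fun i => P.map (X i))
    {A B D : Finset ι} (hAB : Disjoint A B) (hAD : Disjoint A D)
    (h1 : CondIndep P X A B (Finset.univ \ (A ∪ B)))
    (h2 : CondIndep P X A D (Finset.univ \ (A ∪ D))) :
    CondIndep P X A (B ∪ D) (Finset.univ \ (A ∪ (B ∪ D))) := by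
  rw [condIndep_iff_condExp_eq hX] at h1 h2 ⊢
  intro F hF
  have e1 : B ∪ Finset.univ \ (A ∪ B) = Finset.univ \ A := by
    ext i
    have hB' : i ∈ A → i ∉ B := fun h => Finset.disjoint_left.1 hAB h
    simp; tauto
  have e2 : D ∪ Finset.univ \ (A ∪ D) = Finset.univ \ A := by
    ext i
    have hD' : i ∈ A → i ∉ D := fun h => Finset.disjoint_left.1 hAD h
    simp; tauto
  have e3 : B ∪ D ∪ Finset.univ \ (A ∪ (B ∪ D)) = Finset.univ \ A := by
    ext i
    have hB' : i ∈ A → i ∉ B := fun h => Finset.disjoint_left.1 hAB h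
    have hD' : i ∈ A → i ∉ D := fun h => Finset.disjoint_left.1 hAD h
    simp; tauto
  have e4 : (Finset.univ \ (A ∪ B)) ∩ (Finset.univ \ (A ∪ D))
      = Finset.univ \ (A ∪ (B ∪ D)) := by
    ext i
    simp; tauto
  have h1F := h1 F hF
  have h2F := h2 F hF
  rw [e1] at h1F
  rw [e2] at h2F
  obtain ⟨w, hw, hFw⟩ := exists_ae_eq_sigmaAlg_inter hX hpos hdom stronglyMeasurable_condExp
    stronglyMeasurable_condExp (h1F.symm.trans h2F)
  rw [e4] at hw
  rw [e3]
  set R := Finset.univ \ (A ∪ (B ∪ D)) with hR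
  have hle : sigmaAlg X R ≤ sigmaAlg X (Finset.univ \ A) :=
    sigmaAlg_mono X (by rw [hR, ← e3]; exact Finset.subset_union_right)
  have hw' := h1F.trans hFw
  have hwi : Integrable w P := integrable_condExp.congr hw'
  -- conditioning on `X_R` leaves the `X_R`-measurable version `w` unchanged
  refine hw'.trans (Filter.EventuallyEq.symm ?_)
  refine (condExp_condExp_of_le hle (sigmaAlg_le hX _)).symm.trans ?_
  refine (condExp_congr_ae hw').trans ?_
  rw [condExp_of_stronglyMeasurable (sigmaAlg_le hX R) hw hwi]

theorem condIndep_compl_of_forall_singleton_right (hX : ∀ i, Measurable (X i))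
    (hpos : Measure.pi (fun i => P.map (X i)) ≪ P.map fun ω i => X i ω)
    (hdom : P.map (fun ω i => X i ω) ≪ Measure.pi fun i => P.map (X i))
    {A B : Finset ι} (hAB : Disjoint A B) (hB : B.Nonempty)
    (h : ∀ b ∈ B, CondIndep P X A {b} (Finset.univ \ (A ∪ {b}))) :
    CondIndep P X A B (Finset.univ \ (A ∪ B)) := by
  induction hB using Finset.Nonempty.cons_induction with
  | singleton b => exact h b (Finset.mem_singleton_self b)
  | cons b B hb hB ih =>
    rw [Finset.cons_eq_insert, Finset.insert_eq] at hAB h ⊢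
    rw [Finset.disjoint_union_right] at hAB
    exact CondIndep.union_right_compl hX hpos hdom hAB.1 hAB.2 (h b (by simp))
      (ih hAB.2 fun c hc => h c (Finset.mem_union_right _ hc))

/-- Sets of nodes without an edge of the conditional independence graph between them are
conditionally independent given all the remaining nodes. -/
theorem condIndep_compl_of_forall_not_adj (hX : ∀ i, Measurable (X i))
    (hpos : Measure.pi (fun i => P.map (X i)) ≪ P.map fun ω i => X i ω)
    (hdom : P.map (fun ω i => X i ω) ≪ Measure.pi fun i => P.map (X i))
    {A B : Finset ι} (hAB : Disjoint A B) (hA : A.Nonempty) (hB : B.Nonempty)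
    (h : ∀ a ∈ A, ∀ b ∈ B, ¬ (condIndepGraph P X).Adj a b) :
    CondIndep P X A B (Finset.univ \ (A ∪ B)) := by
  refine condIndep_compl_of_forall_singleton_right hX hpos hdom hAB hB fun b hb => ?_
  have hbA : b ∉ A := Finset.disjoint_right.1 hAB hb
  rw [Finset.union_comm]
  refine CondIndep.symm (condIndep_compl_of_forall_singleton_right hX hpos hdom
    (by simpa using hbA) hA fun a ha => ?_)
  have hne : a ≠ b := fun e => hbA (e ▸ ha)
  have := not_not.1 fun hn => h a ha b hb ⟨hne, hn⟩
  rw [Finset.union_comm]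
  exact this.symm

/-- For a positive joint density, the conditional independence graph has the global Markov
property. The set `A` is enlarged to the set `A'` of nodes that walks from `A` reach without meeting
`C`, and `B` to the set of all nodes outside `A' ∪ C`; no edge joins these two sets. -/
theorem condIndep_of_separates_condIndepGraph (hX : ∀ i, Measurable (X i))
    (hpos : Measure.pi (fun i => P.map (X i)) ≪ P.map fun ω i => X i ω)
    (hdom : P.map (fun ω i => X i ω) ≪ Measure.pi fun i => P.map (X i))
    {A B C : Finset ι} (hA : A.Nonempty) (hB : B.Nonempty) (hAC : Disjoint A C)
    (hBC : Disjoint B C) (hsep : Separates (condIndepGraph P X) C A B) :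
    CondIndep P X A B C := by
  classical
  set G := condIndepGraph P X
  let A' : Finset ι := Finset.univ.filter fun v => ∃ a ∈ A, ∃ w : G.Walk a v, ∀ x ∈ w.support, x ∉ C
  let B' : Finset ι := Finset.univ \ (A' ∪ C)
  have hmem (v : ι) : v ∈ A' ↔ ∃ a ∈ A, ∃ w : G.Walk a v, ∀ x ∈ w.support, x ∉ C := by simp [A']
  have hAA' : A ⊆ A' := fun a ha => (hmem a).2 ⟨a, ha, .nil, by
    simpa using Finset.disjoint_left.1 hAC ha⟩
  have hA'C : Disjoint A' C := Finset.disjoint_left.2 fun v hv => by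
    obtain ⟨a, -, w, hw⟩ := (hmem v).1 hv
    exact hw v w.end_mem_support
  have hBB' : B ⊆ B' := fun b hb => by
    have hbC := Finset.disjoint_left.1 hBC hb
    have hbA' : b ∉ A' := fun hb' => by
      obtain ⟨a, ha, w, hw⟩ := (hmem b).1 hb'
      obtain ⟨v, hv, hvC⟩ := hsep a ha b hb w
      exact hw v hv hvC
    simp [B', hbC, hbA']
  have hA'B' : Disjoint A' B' :=
    Finset.disjoint_left.2 fun v hv hv' => (Finset.mem_sdiff.1 hv').2 (Finset.mem_union_left _ hv)
  have hadj : ∀ a ∈ A', ∀ b ∈ B', ¬ G.Adj a b := fun v hv b hb hvb => by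
    obtain ⟨a, ha, w, hw⟩ := (hmem v).1 hv
    have hb' := (Finset.mem_sdiff.1 hb).2
    refine hb' (Finset.mem_union_left _ ((hmem b).2 ⟨a, ha, w.concat hvb, fun x hx => ?_⟩))
    rw [SimpleGraph.Walk.support_concat, List.mem_append,
      List.mem_singleton] at hx
    rcases hx with hx | rfl
    · exact hw x hx
    · exact fun hxC => hb' (Finset.mem_union_right _ hxC)
  have hCeq : Finset.univ \ (A' ∪ B') = C := by
    ext v
    have hCA' : v ∈ C → v ∉ A' := fun h => Finset.disjoint_right.1 hA'C h
    simp only [B', Finset.mem_sdiff, Finset.mem_univ, Finset.mem_union, true_and]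
    tauto
  have := condIndep_compl_of_forall_not_adj hX hpos hdom hA'B' (hA.mono hAA') (hB.mono hBB') hadj
  rw [hCeq] at this
  exact this.mono hAA' hBB'

end Markov

/-! ### Factorization of densities under conditional independence -/

section Densities

variable {Ω α β γ : Type*} [MeasurableSpace Ω] [MeasurableSpace α] [MeasurableSpace β]
  [MeasurableSpace γ] {P : Measure Ω} [IsProbabilityMeasure P]

/-- The conditional probability of `Y ∈ s` given `W`, as a function of the value of `W`: the
integral over `s` of the conditional density `p(y, w) / p(w)`. The value at `p(w) = 0` is
irrelevant. -/
noncomputable def condProbDensity (ρ : Measure α) (τ : Measure γ) (P : Measure Ω) (Y : Ω → α)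
    (W : Ω → γ) (s : Set α) (w : γ) : ℝ≥0∞ :=
  ((P.map W).rnDeriv τ w)⁻¹ *
    ∫⁻ y in s, (P.map fun ω => (Y ω, W ω)).rnDeriv (ρ.prod τ) (y, w) ∂ρ

variable {ρ : Measure α} {σ : Measure β} {τ : Measure γ} [SigmaFinite ρ] [SigmaFinite σ]
  [SigmaFinite τ] {Y : Ω → α} {Z : Ω → β} {W : Ω → γ}

theorem measurable_condProbDensity (ρ : Measure α) [SFinite ρ] (τ : Measure γ) (P : Measure Ω)
    (Y : Ω → α) (W : Ω → γ) (s : Set α) :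
    Measurable (condProbDensity ρ τ P Y W s) :=
  (Measure.measurable_rnDeriv _ _).inv.mul
    (Measurable.lintegral_prod_left' (Measure.measurable_rnDeriv _ _))

theorem setLIntegral_condProbDensity (hY : Measurable Y) (hW : Measurable W)
    (hYW : P.map (fun ω => (Y ω, W ω)) ≪ ρ.prod τ) (hWτ : P.map W ≪ τ)
    {s : Set α} (hs : MeasurableSet s) {r : Set γ} (hr : MeasurableSet r) :
    ∫⁻ ω in W ⁻¹' r, condProbDensity ρ τ P Y W s (W ω) ∂P = P (Y ⁻¹' s ∩ W ⁻¹' r) := by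
  have : IsProbabilityMeasure (P.map W) := Measure.isProbabilityMeasure_map hW.aemeasurable
  have hpair : Measurable fun ω => (Y ω, W ω) := hY.prodMk hW
  have : IsProbabilityMeasure (P.map fun ω => (Y ω, W ω)) :=
    Measure.isProbabilityMeasure_map hpair.aemeasurable
  have hmeas := measurable_condProbDensity ρ τ P Y W s
  set p := (P.map W).rnDeriv τ with hp
  set q := (P.map fun ω => (Y ω, W ω)).rnDeriv (ρ.prod τ) with hq
  have hpm : Measurable p := Measure.measurable_rnDeriv _ _
  have hqm : Measurable q := Measure.measurable_rnDeriv _ _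
  have hrect (r' : Set γ) (hr' : MeasurableSet r') :
      ∫⁻ w in r', ∫⁻ y in s, q (y, w) ∂ρ ∂τ = P (Y ⁻¹' s ∩ W ⁻¹' r') := by
    have h1 := Measure.setLIntegral_rnDeriv hYW (s ×ˢ r')
    rw [Measure.map_apply hpair (hs.prod hr'), ← Measure.prod_restrict,
      lintegral_prod_symm _ hqm.aemeasurable] at h1
    exact h1
  -- `W` almost surely avoids the zeros of `p`, so the joint density vanishes there as well, and
  -- `p * p⁻¹ = 0` at these points does no harm
  have hzero : ∀ᵐ w ∂τ, p w = 0 → ∫⁻ y in s, q (y, w) ∂ρ = 0 := by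
    have h0 : MeasurableSet {w | p w = 0} := hpm (measurableSet_singleton 0)
    refine (ae_restrict_iff' h0).1 ((lintegral_eq_zero_iff ?_).1 ?_)
    · exact hqm.lintegral_prod_left'
    · rw [hrect _ h0]
      refine measure_mono_null Set.inter_subset_right ?_
      rw [← Measure.map_apply hW h0, ← Measure.setLIntegral_rnDeriv hWτ]
      exact setLIntegral_eq_zero h0 fun w hw => hw
  rw [← lintegral_indicator (hW hr)]
  have hind : (fun ω => (W ⁻¹' r).indicator (fun ω => condProbDensity ρ τ P Y W s (W ω)) ω)
      = fun ω => r.indicator (condProbDensity ρ τ P Y W s) (W ω) := rfl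
  rw [hind, ← lintegral_map (hmeas.indicator hr) hW,
    ← lintegral_rnDeriv_mul hWτ (hmeas.indicator hr).aemeasurable, ← hrect r hr,
    ← lintegral_indicator hr]
  refine lintegral_congr_ae ?_
  filter_upwards [hzero, Measure.rnDeriv_ne_top (P.map W) τ] with w hw0 hwt
  by_cases hwr : w ∈ r
  · simp only [Set.indicator_of_mem hwr, condProbDensity]
    by_cases h0 : p w = 0
    · rw [hw0 h0, mul_zero, mul_zero]
    · rw [← mul_assoc, ENNReal.mul_inv_cancel h0 hwt, one_mul]
  · simp [Set.indicator_of_notMem hwr]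

theorem condProbDensity_ae_eq_condExp (hY : Measurable Y) (hW : Measurable W)
    (hYW : P.map (fun ω => (Y ω, W ω)) ≪ ρ.prod τ) (hWτ : P.map W ≪ τ)
    {s : Set α} (hs : MeasurableSet s) :
    (fun ω => condProbDensity ρ τ P Y W s (W ω)) =ᵐ[P]
      fun ω => ENNReal.ofReal ((P⟦Y ⁻¹' s | MeasurableSpace.comap W inferInstance⟧) ω) := by
  have hmeas : Measurable fun ω => condProbDensity ρ τ P Y W s (W ω) :=
    (measurable_condProbDensity ρ τ P Y W s).comp hW
  have hfin : ∫⁻ ω, condProbDensity ρ τ P Y W s (W ω) ∂P ≠ ∞ := by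
    have := setLIntegral_condProbDensity hY hW hYW hWτ hs MeasurableSet.univ
    rw [Set.preimage_univ, Measure.restrict_univ] at this
    rw [this]
    exact measure_ne_top _ _
  have hint := integrable_toReal_of_lintegral_ne_top hmeas.aemeasurable hfin
  have hlt := ae_lt_top hmeas hfin
  have hce : (fun ω => (condProbDensity ρ τ P Y W s (W ω)).toReal) =ᵐ[P]
      P⟦Y ⁻¹' s | MeasurableSpace.comap W inferInstance⟧ := by
    refine ae_eq_condExp_of_forall_setIntegral_eq hW.comap_le (integrable_indicator_one (hY hs))
      (fun _ _ _ => hint.integrableOn) ?_ ?_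
    · rintro _ ⟨r, hr, rfl⟩ -
      rw [integral_toReal hmeas.aemeasurable (ae_restrict_of_ae hlt),
        setLIntegral_condProbDensity hY hW hYW hWτ hs hr, setIntegral_indicator (hY hs),
        setIntegral_const, smul_eq_mul, mul_one, Set.inter_comm]
      rfl
    · exact (((measurable_condProbDensity ρ τ P Y W s).ennreal_toReal.comp
        (comap_measurable W)).stronglyMeasurable).aestronglyMeasurable
  filter_upwards [hce, hlt] with ω h1 h2
  rw [← h1, ENNReal.ofReal_toReal h2.ne]

/-- If, given `W = φ(Z)`, the variable `Z` carries no further information on `Y`, then the joint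
density of `(Y, Z)` is the product of the conditional density of `Y` given `W` and the density of
`Z`. Both sides integrate to `P(Y ∈ s, Z ∈ t)` over a rectangle `s × t`. -/
theorem rnDeriv_prod_ae_eq_of_condExp_eq (hY : Measurable Y) (hZ : Measurable Z) {φ : β → γ}
    (hφ : Measurable φ) (hYZ : P.map (fun ω => (Y ω, Z ω)) ≪ ρ.prod σ) (hZσ : P.map Z ≪ σ)
    (hYW : P.map (fun ω => (Y ω, φ (Z ω))) ≪ ρ.prod τ) (hWτ : P.map (fun ω => φ (Z ω)) ≪ τ)
    (h : ∀ s, MeasurableSet s → P⟦Y ⁻¹' s | MeasurableSpace.comap Z inferInstance⟧ =ᵐ[P]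
      P⟦Y ⁻¹' s | MeasurableSpace.comap (fun ω => φ (Z ω)) inferInstance⟧) :
    ∀ᵐ ω ∂P, (P.map fun ω => (Y ω, Z ω)).rnDeriv (ρ.prod σ) (Y ω, Z ω) =
      (P.map Z).rnDeriv σ (Z ω) * (((P.map fun ω => φ (Z ω)).rnDeriv τ (φ (Z ω)))⁻¹ *
        (P.map fun ω => (Y ω, φ (Z ω))).rnDeriv (ρ.prod τ) (Y ω, φ (Z ω))) := by
  have hW : Measurable fun ω => φ (Z ω) := hφ.comp hZ
  have hpair : Measurable fun ω => (Y ω, Z ω) := hY.prodMk hZ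
  have : IsProbabilityMeasure (P.map Z) := Measure.isProbabilityMeasure_map hZ.aemeasurable
  have : IsProbabilityMeasure (P.map fun ω => (Y ω, Z ω)) :=
    Measure.isProbabilityMeasure_map hpair.aemeasurable
  set pZ := (P.map Z).rnDeriv σ with hpZ
  set pW := (P.map fun ω => φ (Z ω)).rnDeriv τ with hpW
  set pYW := (P.map fun ω => (Y ω, φ (Z ω))).rnDeriv (ρ.prod τ) with hpYW
  have hpZm : Measurable pZ := Measure.measurable_rnDeriv _ _
  have hpWm : Measurable pW := Measure.measurable_rnDeriv _ _
  have hpYWm : Measurable pYW := Measure.measurable_rnDeriv _ _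
  let f : α × β → ℝ≥0∞ := fun z => pZ z.2 * ((pW (φ z.2))⁻¹ * pYW (z.1, φ z.2))
  have hf : Measurable f := by fun_prop
  have hlaw : P.map (fun ω => (Y ω, Z ω)) = (ρ.prod σ).withDensity f := by
    refine Measure.ext_prod fun {s t} hs ht => ?_
    have hk : Measurable (condProbDensity ρ τ P Y (fun ω => φ (Z ω)) s) :=
      measurable_condProbDensity ρ τ P Y _ s
    have hint : Integrable (P⟦Y ⁻¹' s | MeasurableSpace.comap Z inferInstance⟧) P :=
      integrable_condExp
    have hnonneg : 0 ≤ᵐ[P] P⟦Y ⁻¹' s | MeasurableSpace.comap Z inferInstance⟧ :=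
      condExp_nonneg (ae_of_all _ fun ω => Set.indicator_nonneg (fun _ _ => zero_le_one) ω)
    symm
    calc (ρ.prod σ).withDensity f (s ×ˢ t)
        = ∫⁻ z in t, ∫⁻ y in s, f (y, z) ∂ρ ∂σ := by
          rw [withDensity_apply _ (hs.prod ht), ← Measure.prod_restrict,
            lintegral_prod_symm _ hf.aemeasurable]
      _ = ∫⁻ z in t, pZ z * condProbDensity ρ τ P Y (fun ω => φ (Z ω)) s (φ z) ∂σ := by
          refine lintegral_congr fun z => ?_
          simp only [f]
          rw [lintegral_const_mul _ (by fun_prop), lintegral_const_mul _ (by fun_prop)]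
          rfl
      _ = ∫⁻ z in t, condProbDensity ρ τ P Y (fun ω => φ (Z ω)) s (φ z) ∂(P.map Z) :=
          setLIntegral_rnDeriv_mul hZσ (hk.comp hφ).aemeasurable ht
      _ = ∫⁻ ω in Z ⁻¹' t, condProbDensity ρ τ P Y (fun ω => φ (Z ω)) s (φ (Z ω)) ∂P :=
          setLIntegral_map ht (hk.comp hφ) hZ
      _ = ∫⁻ ω in Z ⁻¹' t, ENNReal.ofReal
            ((P⟦Y ⁻¹' s | MeasurableSpace.comap Z inferInstance⟧) ω) ∂P := by
          refine lintegral_congr_ae (ae_restrict_of_ae ?_)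
          filter_upwards [condProbDensity_ae_eq_condExp hY hW hYW hWτ hs, h s hs] with ω h1 h2
          rw [h1, h2]
      _ = ENNReal.ofReal (∫ ω in Z ⁻¹' t,
            (P⟦Y ⁻¹' s | MeasurableSpace.comap Z inferInstance⟧) ω ∂P) :=
          (ofReal_integral_eq_lintegral_ofReal hint.integrableOn
            (ae_restrict_of_ae hnonneg)).symm
      _ = P.map (fun ω => (Y ω, Z ω)) (s ×ˢ t) := by
          rw [setIntegral_condExp hZ.comap_le (integrable_indicator_one (hY hs)) ⟨t, ht, rfl⟩,
            setIntegral_indicator (hY hs), setIntegral_const, smul_eq_mul, mul_one,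
            ofReal_measureReal, Measure.map_apply hpair (hs.prod ht), Set.inter_comm]
          rfl
  have hder : (P.map fun ω => (Y ω, Z ω)).rnDeriv (ρ.prod σ) =ᵐ[ρ.prod σ] f := by
    rw [hlaw]
    exact Measure.rnDeriv_withDensity _ hf
  exact ae_of_ae_map hpair.aemeasurable (hYZ.ae_le hder)

end Densities

/-! ### Additivity of the conditional entropy -/

section Entropy

theorem piFinsetUnion_subvector {ι Ω : Type*} [DecidableEq ι] {E : ι → Type*}
    [∀ i, MeasurableSpace (E i)] {X : ∀ i, Ω → E i} {S T : Finset ι} (hST : Disjoint S T) (ω : Ω) :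
    MeasurableEquiv.piFinsetUnion E hST (subvector X S ω, subvector X T ω)
      = subvector X (S ∪ T) ω := by
  ext ⟨i, hi⟩
  rcases Finset.mem_union.1 hi with h | h
  · exact Equiv.piFinsetUnion_left E hST h hi
  · exact Equiv.piFinsetUnion_right E hST h hi

variable {ι Ω : Type*} {E : ι → Type*} [∀ i, MeasurableSpace (E i)]
  [MeasurableSpace Ω] {μ : ∀ i, Measure (E i)} [∀ i, SigmaFinite (μ i)]
  {P : Measure Ω} [IsProbabilityMeasure P] {X : ∀ i, Ω → E i}

theorem density_pos_and_ne_top (hX : ∀ i, Measurable (X i)) {S : Finset ι}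
    (hS : P.map (subvector X S) ≪ Measure.pi fun i : S => μ i) :
    ∀ᵐ ω ∂P, 0 < density μ P X S (subvector X S ω) ∧ density μ P X S (subvector X S ω) ≠ ∞ := by
  have hm := measurable_subvector hX S
  have : IsProbabilityMeasure (P.map (subvector X S)) :=
    Measure.isProbabilityMeasure_map hm.aemeasurable
  filter_upwards [ae_of_ae_map hm.aemeasurable (Measure.rnDeriv_pos hS),
    ae_of_ae_map hm.aemeasurable (hS.ae_le
      (Measure.rnDeriv_ne_top (P.map (subvector X S)) (Measure.pi fun i : S => μ i)))] with ω h1 h2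
  exact ⟨h1, h2⟩

variable [DecidableEq ι]

theorem density_union (hX : ∀ i, Measurable (X i)) {S T : Finset ι} (hST : Disjoint S T)
    (hac : P.map (subvector X (S ∪ T)) ≪ Measure.pi fun i : (S ∪ T : Finset ι) => μ i) :
    P.map (fun ω => (subvector X S ω, subvector X T ω)) ≪
      (Measure.pi fun i : S => μ i).prod (Measure.pi fun i : T => μ i) ∧
    ∀ᵐ ω ∂P, density μ P X (S ∪ T) (subvector X (S ∪ T) ω) =
      (P.map fun ω => (subvector X S ω, subvector X T ω)).rnDeriv
        ((Measure.pi fun i : S => μ i).prod (Measure.pi fun i : T => μ i))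
        (subvector X S ω, subvector X T ω) := by
  set e := MeasurableEquiv.piFinsetUnion E hST with he
  have hmp := measurePreserving_piFinsetUnion hST μ
  have hm : Measurable fun ω => (subvector X S ω, subvector X T ω) :=
    (measurable_subvector hX S).prodMk (measurable_subvector hX T)
  have : IsProbabilityMeasure (P.map fun ω => (subvector X S ω, subvector X T ω)) :=
    Measure.isProbabilityMeasure_map hm.aemeasurable
  have hlaw : P.map (subvector X (S ∪ T))
      = (P.map fun ω => (subvector X S ω, subvector X T ω)).map e := by
    rw [Measure.map_map e.measurable hm]
    congr 1
    ext1 ω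
    exact (piFinsetUnion_subvector hST ω).symm
  have hac' : P.map (fun ω => (subvector X S ω, subvector X T ω)) ≪
      (Measure.pi fun i : S => μ i).prod (Measure.pi fun i : T => μ i) := by
    have := hac.map e.symm.measurable
    rwa [hlaw, ← hmp.map_eq, MeasurableEquiv.map_symm_map, MeasurableEquiv.map_symm_map] at this
  refine ⟨hac', ?_⟩
  have h := e.measurableEmbedding.rnDeriv_map (P.map fun ω => (subvector X S ω, subvector X T ω))
    ((Measure.pi fun i : S => μ i).prod (Measure.pi fun i : T => μ i))
  filter_upwards [ae_of_ae_map hm.aemeasurable (hac'.ae_le h)] with ω hω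
  rw [← hω, density, hlaw, ← hmp.map_eq, piFinsetUnion_subvector]

/-- Under conditional independence, `f_{A ∪ B ∪ C} f_C = f_{A ∪ C} f_{B ∪ C}`, in logarithmic
form. -/
theorem logDensity_add_of_condIndep (hX : ∀ i, Measurable (X i))
    (hac : ∀ S : Finset ι, P.map (subvector X S) ≪ Measure.pi fun i : S => μ i)
    {A B C : Finset ι} (hAB : Disjoint A B) (hAC : Disjoint A C) (h : CondIndep P X A B C) :
    ∀ᵐ ω ∂P, logDensity μ P X (A ∪ (B ∪ C)) ω + logDensity μ P X C ω
      = logDensity μ P X (A ∪ C) ω + logDensity μ P X (B ∪ C) ω := by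
  have hA_BC : Disjoint A (B ∪ C) := Finset.disjoint_union_right.2 ⟨hAB, hAC⟩
  obtain ⟨hac1, hd1⟩ := density_union hX hA_BC (hac _)
  obtain ⟨hac2, hd2⟩ := density_union hX hAC (hac _)
  let φ : (∀ i : (B ∪ C : Finset ι), E i) → ∀ i : C, E i :=
    fun x i => x ⟨i, Finset.mem_union_right _ i.2⟩
  have hφ : Measurable φ := by fun_prop
  have hce := (condIndep_iff_condExp_eq hX).1 h
  have hfac := rnDeriv_prod_ae_eq_of_condExp_eq (measurable_subvector hX A)
    (measurable_subvector hX (B ∪ C)) hφ hac1 (hac _) hac2 (hac C)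
    fun s hs => hce _ ⟨s, hs, rfl⟩
  filter_upwards [hd1, hd2, hfac, density_pos_and_ne_top hX (hac C),
    density_pos_and_ne_top hX (hac (A ∪ C)), density_pos_and_ne_top hX (hac (B ∪ C))]
    with ω h1 h2 h3 ⟨hC0, hCt⟩ ⟨hAC0, hACt⟩ ⟨hBC0, hBCt⟩
  have h4 : density μ P X (A ∪ (B ∪ C)) (subvector X (A ∪ (B ∪ C)) ω) =
      density μ P X (B ∪ C) (subvector X (B ∪ C) ω) *
        ((density μ P X C (subvector X C ω))⁻¹ *
          density μ P X (A ∪ C) (subvector X (A ∪ C) ω)) := by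
    rw [h1, h2, h3]
    rfl
  have hCr := (ENNReal.toReal_pos hC0.ne' hCt).ne'
  have hACr := (ENNReal.toReal_pos hAC0.ne' hACt).ne'
  have hBCr := (ENNReal.toReal_pos hBC0.ne' hBCt).ne'
  simp only [logDensity]
  rw [h4, ENNReal.toReal_mul, ENNReal.toReal_mul, ENNReal.toReal_inv,
    Real.log_mul hBCr (mul_ne_zero (inv_ne_zero hCr) hACr),
    Real.log_mul (inv_ne_zero hCr) hACr, Real.log_inv]
  ring

/-- The chain rule for entropies, `h_{S|C} = h_{S ∪ C} - h_C`. -/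
theorem condEntropy_eq_sub (hX : ∀ i, Measurable (X i))
    (hac : ∀ S : Finset ι, P.map (subvector X S) ≪ Measure.pi fun i : S => μ i)
    (hent : ∀ S : Finset ι, Integrable (logDensity μ P X S) P) (S C : Finset ι) :
    condEntropy μ P X S C
      = (-∫ ω, logDensity μ P X (S ∪ C) ω ∂P) - -∫ ω, logDensity μ P X C ω ∂P := by
  have h : (fun ω => Real.log (condDensity μ P X S C ω)) =ᵐ[P]
      fun ω => logDensity μ P X (S ∪ C) ω - logDensity μ P X C ω := by
    filter_upwards [density_pos_and_ne_top hX (hac C), density_pos_and_ne_top hX (hac (S ∪ C))]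
      with ω ⟨hC0, hCt⟩ ⟨hS0, hSt⟩
    exact Real.log_div (ENNReal.toReal_pos hS0.ne' hSt).ne' (ENNReal.toReal_pos hC0.ne' hCt).ne'
  rw [condEntropy, integral_congr_ae h, integral_sub (hent _) (hent _)]
  ring

theorem condEntropy_union_of_condIndep (hX : ∀ i, Measurable (X i))
    (hac : ∀ S : Finset ι, P.map (subvector X S) ≪ Measure.pi fun i : S => μ i)
    (hent : ∀ S : Finset ι, Integrable (logDensity μ P X S) P)
    {A B C : Finset ι} (hAB : Disjoint A B) (hAC : Disjoint A C) (h : CondIndep P X A B C) :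
    condEntropy μ P X (A ∪ B) C = condEntropy μ P X A C + condEntropy μ P X B C := by
  have hint := integral_congr_ae (logDensity_add_of_condIndep hX hac hAB hAC h)
  rw [integral_add (hent _) (hent _), integral_add (hent _) (hent _)] at hint
  simp only [condEntropy_eq_sub hX hac hent, Finset.union_assoc]
  linarith

end Entropy

/-! ### The forward difference of an additive set function -/

section Difference

variable {ι : Type*} [DecidableEq ι]

theorem sum_powerset_union_of_disjoint {M : Type*} [AddCommMonoid M] {A B : Finset ι}
    (hAB : Disjoint A B) (g : Finset ι → M) :
    ∑ D ∈ (A ∪ B).powerset, g D = ∑ S ∈ A.powerset, ∑ T ∈ B.powerset, g (S ∪ T) := by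
  rw [← Finset.sum_product']
  refine (Finset.sum_nbij' (fun p => p.1 ∪ p.2) (fun D => (D ∩ A, D ∩ B)) ?_ ?_ ?_ ?_ ?_).symm
  · simp only [Finset.mem_product, Finset.mem_powerset]
    exact fun p hp => Finset.union_subset_union hp.1 hp.2
  · simp only [Finset.mem_product, Finset.mem_powerset]
    exact fun D _ => ⟨Finset.inter_subset_right, Finset.inter_subset_right⟩
  · rintro ⟨S, T⟩ hp
    simp only [Finset.mem_product, Finset.mem_powerset] at hp
    have h1 : Disjoint T A := (hAB.mono_right hp.2).symm
    have h2 : Disjoint S B := hAB.mono_left hp.1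
    simp [Finset.union_inter_distrib_right, Finset.inter_eq_left.2 hp.1,
      Finset.inter_eq_left.2 hp.2, Finset.disjoint_iff_inter_eq_empty.1 h1,
      Finset.disjoint_iff_inter_eq_empty.1 h2]
  · intro D hD
    rw [← Finset.inter_union_distrib_left]
    exact Finset.inter_eq_left.2 (Finset.mem_powerset.1 hD)
  · intro p _
    rfl

/-- The forward difference at `A ∪ B` of `S ↦ h S` vanishes if `h` is additive across the partition
into `A` and `B`: each of the two summands is constant in one of the two blocks, over which the
alternating sum is zero. -/
theorem forwardDiff_union_eq_zero {h : Finset ι → ℝ} {A B : Finset ι} (hA : A.Nonempty)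
    (hB : B.Nonempty) (hAB : Disjoint A B)
    (hadd : ∀ S ⊆ A, ∀ T ⊆ B, h (S ∪ T) = h S + h T) : forwardDiff h (A ∪ B) = 0 := by
  have hzero {U : Finset ι} (hU : U.Nonempty) :
      ∑ T ∈ U.powerset, (-1 : ℝ) ^ (U.card - T.card) = 0 := by
    have h1 := Finset.sum_powerset_neg_one_pow_card_of_nonempty hU
    have h2 : ∀ T ∈ U.powerset,
        (-1 : ℝ) ^ (U.card - T.card) = (-1) ^ U.card * ((-1) ^ T.card : ℤ) := by
      intro T hT
      have hle := Finset.card_le_card (Finset.mem_powerset.1 hT)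
      push_cast
      rw [← pow_add, ← Nat.sub_add_cancel hle, Nat.add_sub_cancel, add_assoc, ← two_mul,
        pow_add _ _ (2 * T.card), pow_mul, neg_one_sq, one_pow, mul_one]
    rw [Finset.sum_congr rfl h2, ← Finset.mul_sum, ← Int.cast_sum, h1, Int.cast_zero, mul_zero]
  have hterm : ∀ S ∈ A.powerset, ∀ T ∈ B.powerset,
      (-1 : ℝ) ^ ((A ∪ B).card - (S ∪ T).card) * h (S ∪ T) =
        ((-1) ^ (A.card - S.card) * h S) * (-1) ^ (B.card - T.card) +
          (-1) ^ (A.card - S.card) * ((-1) ^ (B.card - T.card) * h T) := by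
    intro S hS T hT
    rw [Finset.mem_powerset] at hS hT
    have hS' := Finset.card_le_card hS
    have hT' := Finset.card_le_card hT
    rw [Finset.card_union_of_disjoint hAB,
      Finset.card_union_of_disjoint (hAB.mono hS hT), hadd S hS T hT,
      show A.card + B.card - (S.card + T.card) = (A.card - S.card) + (B.card - T.card) by omega,
      pow_add]
    ring
  rw [forwardDiff, sum_powerset_union_of_disjoint hAB,
    Finset.sum_congr rfl fun S hS => Finset.sum_congr rfl fun T hT => hterm S hS T hT]
  simp only [Finset.sum_add_distrib, ← Finset.mul_sum, hzero hB, mul_zero, zero_add]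
  rw [← Finset.sum_mul, hzero hA, zero_mul]

end Difference

/-! ### Separation and the forward difference -/

section Separation

variable {ι Ω : Type*} [Fintype ι] {E : ι → Type*} [∀ i, MeasurableSpace (E i)]
  [MeasurableSpace Ω] {μ : ∀ i, Measure (E i)} [∀ i, SigmaFinite (μ i)]
  {P : Measure Ω} {X : ∀ i, Ω → E i}

theorem map_subvector_absolutelyContinuous (hX : ∀ i, Measurable (X i))
    (hac : P.map (fun ω i => X i ω) ≪ Measure.pi μ) (S : Finset ι) :
    P.map (subvector X S) ≪ Measure.pi fun i : S => μ i := by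
  have hr := quasiMeasurePreserving_finset_restrict μ S
  have hlaw : P.map (subvector X S)
      = (P.map fun ω i => X i ω).map fun x (i : S) => x i :=
    (Measure.map_map hr.measurable (measurable_pi_lambda _ hX)).symm
  rw [hlaw]
  exact (hac.map hr.measurable).trans hr.absolutelyContinuous

theorem map_absolutelyContinuous_pi_map [IsProbabilityMeasure P] (hX : ∀ i, Measurable (X i))
    (hac : P.map (fun ω i => X i ω) ≪ Measure.pi μ) :
    P.map (fun ω i => X i ω) ≪ Measure.pi fun i => P.map (X i) := by
  have hm : Measurable fun ω i => X i ω := measurable_pi_lambda _ hX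
  have : IsProbabilityMeasure (P.map fun ω i => X i ω) :=
    Measure.isProbabilityMeasure_map hm.aemeasurable
  have h := absolutelyContinuous_pi_map_eval hac
  have hmarg (i : ι) : (P.map fun ω i => X i ω).map (fun x => x i) = P.map (X i) :=
    Measure.map_map (measurable_pi_apply i) hm
  simpa only [hmarg] using h

theorem condForwardDiff_union_eq_zero_of_condIndep [DecidableEq ι] [IsProbabilityMeasure P]
    (hX : ∀ i, Measurable (X i)) (hac : P.map (fun ω i => X i ω) ≪ Measure.pi μ)
    (hent : ∀ S : Finset ι, Integrable (logDensity μ P X S) P)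
    {A B C : Finset ι} (hA : A.Nonempty) (hB : B.Nonempty) (hAB : Disjoint A B)
    (hAC : Disjoint A C) (h : CondIndep P X A B C) :
    condForwardDiff μ P X (A ∪ B) C = 0 :=
  forwardDiff_union_eq_zero hA hB hAB fun _ hS _ hT =>
    condEntropy_union_of_condIndep hX (map_subvector_absolutelyContinuous hX hac) hent
      (hAB.mono hS hT) (hAC.mono_left hS) (h.mono hS hT)

end Separation

end ForwardDifference

theorem mainTheorem6 {ι Ω : Type*} [Fintype ι] [DecidableEq ι] {E : ι → Type*}
    [∀ i, MeasurableSpace (E i)] [MeasurableSpace Ω]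
    (μ : ∀ i, Measure (E i)) [∀ i, SigmaFinite (μ i)]
    (P : Measure Ω) [IsProbabilityMeasure P]
    (X : ∀ i, Ω → E i) (hX : ∀ i, Measurable (X i))
    -- the joint law has a density, and all the entropies are well defined
    (hac : P.map (fun ω i => X i ω) ≪ Measure.pi μ)
    (hent : ∀ S : Finset ι, Integrable (ForwardDifference.logDensity μ P X S) P)
    (A B C : Finset ι) (hA : A.Nonempty) (hB : B.Nonempty)
    (hAB : Disjoint A B) (hAC : Disjoint A C) (hBC : Disjoint B C) :
    -- the conditional independence graph, for a joint density that is positive almost everywhere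
    -- on the product of the marginal supports
    (Measure.pi (fun i => P.map (X i)) ≪ P.map (fun ω i => X i ω) →
      ForwardDifference.Separates (ForwardDifference.condIndepGraph P X) C A B →
        ForwardDifference.CondIndep P X A B C ∧
        ForwardDifference.condEntropy μ P X (A ∪ B) C =
          ForwardDifference.condEntropy μ P X A C + ForwardDifference.condEntropy μ P X B C ∧
        ForwardDifference.condForwardDiff μ P X (A ∪ B) C = 0) ∧
    -- any graph with the global Markov property, without positivity
    (∀ G : SimpleGraph ι, ForwardDifference.IsGlobalMarkov G P X →
      ForwardDifference.Separates G C A B →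
        ForwardDifference.CondIndep P X A B C ∧
        ForwardDifference.condEntropy μ P X (A ∪ B) C =
          ForwardDifference.condEntropy μ P X A C + ForwardDifference.condEntropy μ P X B C ∧
        ForwardDifference.condForwardDiff μ P X (A ∪ B) C = 0) := by
  have hS := ForwardDifference.map_subvector_absolutelyContinuous hX hac
  have hdom := ForwardDifference.map_absolutelyContinuous_pi_map hX hac
  have main (h : ForwardDifference.CondIndep P X A B C) :=
    And.intro h (And.intro
      (ForwardDifference.condEntropy_union_of_condIndep hX hS hent hAB hAC h)
      (ForwardDifference.condForwardDiff_union_eq_zero_of_condIndep hX hac hent hA hB hAB hAC h))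
  exact ⟨fun hpos hsep => main (ForwardDifference.condIndep_of_separates_condIndepGraph hX hpos
    hdom hA hB hAC hBC hsep), fun G hG hsep => main (hG A B C hAB hAC hBC hsep)⟩
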